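/- Let $p$ be a prime and let $\Bbbk$ be a field of characteristic $p$ that is $F$-finite (the Frobenius map $x \mapsto x^p$ is a finite ring homomorphism). Let $g_1,\dots,g_m \in \Bbbk[x] = \Bbbk[x_1,\dots,x_n]$ be nonzero polynomials, let $\mathfrak a = \langle g_1,\dots,g_m\rangle$, and let $\mathfrak b$ be a proper monomial ideal of $\Bbbk[x]$ (i.e. a proper ideal generated by monomials) with $\mathfrak a \subseteq \sqrt{\mathfrak b}$ (so that $\mathfrak a$ is proper as well). Notation. For an ideal $I$ of a ring of characteristic $p$ and a power $q$ of $p$, $I^{[q]} = \langle f^q : f \in I\rangle$. For $k \in \mathbb N$ with base $p$ expansion $k = k_0 + k_1 p + \cdots + k_r p^r$, set $I^{[k]} = I^{k_0} (I^{k_1})^{[p]} \cdots (I^{k_r})^{[p^r]}$. For ideals $\mathfrak c \subseteq \sqrt{\mathfrak d}$ with $\mathfrak d$ proper, in a polynomial ring over a field of characteristic $p$, set \[ \mathrm{ft}^{\mathfrak d}(\mathfrak c) = \sup_{q} \frac{\max\{k : \mathfrak c^k \not\subseteq \mathfrak d^{[q]}\}}{q}, \qquad \mathrm{crit}^{\mathfrak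 d}(\mathfrak c) = \sup_{q} \frac{\max\{k : \mathfrak c^{[k]} \not\subseteq \mathfrak d^{[q]}\}}{q}, \] where $q$ ranges over all powers $p^e$, $e \ge 0$; write $\mathrm{ft}^{\mathfrak d}(f) = \mathrm{ft}^{\mathfrak d}(\langle f\rangle)$. For a field extension $\mathbb L$ of $\Bbbk$, $\mathfrak b_{\mathbb L}$ is the extension of $\mathfrak b$ to $\mathbb L[x]$. For a closed set $V$ of $\mathbb A^m_{\Bbbk}$ (given by polynomial equations with coefficients in $\Bbbk$), $V_{\mathbb L} \subseteq \mathbb L^m$ is the set of solutions in $\mathbb L^m$ of the same equations. Then: (1) There exists a closed set $V$ of $\mathbb A^m_{\Bbbk}$ such that, for every $F$-finite field $\mathbb L$ containing $\Bbbk$ and every $\gamma = (\gamma_1,\dots,\gamma_m) \in \mathbb L^m$ for which $g = \gamma_1 g_1 + \cdots + \gamma_m g_m \in \mathbb L[x]$ is nonzero, \[ \mathrm{ft}^{\mathfrak b_{\mathbb L}}(g) = \mathrm{crit}^{\mathfrak b}(\mathfrak a) \iff \gamma \notin V_{\mathbb L}. \] (2) If $\Bbbk$ is infinite, then $\mathrm{crit}^{\mathfrak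 b}(\mathfrak a) = \max\{\mathrm{ft}^{\mathfrak b}(f) : f \in \mathfrak a\}$. -/

import Mathlib

universe u v

/-- A commutative ring of prime characteristic `p` is `F`-finite if its Frobenius endomorphism
`x ↦ x ^ p` is a finite ring homomorphism. -/
def IsFFinite (p : ℕ) (A : Type*) [CommRing A] [ExpChar A p] : Prop :=
  (frobenius A p).Finite

/-- The standard Frobenius power `I^[q]`: the ideal generated by the `q`-th powers of all the
elements of `I` (used for `q` a power of the characteristic). -/
def bracketPower {R : Type*} [CommRing R] (I : Ideal R) (q : ℕ) : Ideal R :=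
  Ideal.span {y : R | ∃ f ∈ I, y = f ^ q}

/-- The integral Frobenius power `a^[k]` for an arbitrary natural number `k`: if
`k = k₀ + k₁ p + ⋯ + k_r p ^ r` is the base `p` expansion of `k`, it is the product of the ideals
`(a ^ kᵢ)^[p ^ i]`. -/
noncomputable def frobPower (p : ℕ) {R : Type*} [CommRing R] (a : Ideal R) (k : ℕ) : Ideal R :=
  ∏ i ∈ Finset.range (Nat.digits p k).length,
    bracketPower (a ^ ((Nat.digits p k).getD i 0)) (p ^ i)

/-- `ν_a^b(q) = max {k : a ^ k ⊄ b^[q]}`. -/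
noncomputable def fNu {R : Type*} [CommRing R] (b a : Ideal R) (q : ℕ) : ℕ :=
  sSup {k : ℕ | ¬ a ^ k ≤ bracketPower b q}

/-- `μ_a^b(q) = max {k : a^[k] ⊄ b^[q]}`, with integral Frobenius powers of `a` in place of the
regular powers. -/
noncomputable def critMu (p : ℕ) {R : Type*} [CommRing R] (b a : Ideal R) (q : ℕ) : ℕ :=
  sSup {k : ℕ | ¬ frobPower p a k ≤ bracketPower b q}

/-- The `F`-threshold `ft^b(a) = sup_q ν_a^b(q) / q` over all powers `q = p ^ e`. -/
noncomputable def fThreshold (p : ℕ) {R : Type*} [CommRing R] (b a : Ideal R) : ℝ :=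
  ⨆ e : ℕ, (fNu b a (p ^ e) : ℝ) / (p : ℝ) ^ e

/-- The critical Frobenius exponent `crit^b(a) = sup_q μ_a^b(q) / q` over all powers
`q = p ^ e`. -/
noncomputable def critExponent (p : ℕ) {R : Type*} [CommRing R] (b a : Ideal R) : ℝ :=
  ⨆ e : ℕ, (critMu p b a (p ^ e) : ℝ) / (p : ℝ) ^ e

/-- An ideal of a polynomial ring is monomial if it is generated by monomials. -/
def IsMonomialIdeal {σ K : Type*} [CommRing K] (I : Ideal (MvPolynomial σ K)) : Prop :=
  ∃ S : Set (σ →₀ ℕ), I = Ideal.span ((fun u => MvPolynomial.monomial u (1 : K)) '' S)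

/-- The extension `d_L` of an ideal `d` of `K[x]` to `L[x]`. -/
noncomputable def extendIdeal {σ K : Type*} [CommRing K] (L : Type*) [CommRing L] [Algebra K L]
    (d : Ideal (MvPolynomial σ K)) : Ideal (MvPolynomial σ L) :=
  d.map (MvPolynomial.map (algebraMap K L))

/-- The linear combination `γ₁ g₁ + ⋯ + γ_m g_m` in `L[x]` of polynomials `gᵢ ∈ K[x]`, with
coefficients `γᵢ ∈ L`. -/
noncomputable def linComb {σ K : Type*} [CommRing K] {L : Type*} [CommRing L] [Algebra K L]
    {m : ℕ} (g : Fin m → MvPolynomial σ K) (γ : Fin m → L) : MvPolynomial σ L :=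
  ∑ i, MvPolynomial.C (γ i) * MvPolynomial.map (algebraMap K L) (g i)

/-! Let G = z₁g₁ + ⋯ + z_m g_m with independent transcendentals zᵢ. The coefficients in k[x] of G^j,
viewed as a polynomial in z, generate a^[j] (`coeffIdeal_linearForm_pow_eq_frobPower`). Hence
crit^b(a) is the F-threshold of the single polynomial G over k(z)
(`critExponent_eq_fThreshold_genericComb`), and each combination g_γ is a specialization of G.

A nonzero f in the radical of b satisfies ν(q)/q < ft(f) ≤ (ν(q)+1)/q. If moreover its degree in
each variable is at most D, then (p^j - p^i) ft(f) is an integer for some i < j ≤ N = (D+1)^n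
(`exists_pow_sub_pow_mul_fThreshold`), so two such thresholds closer than p^(-2N) coincide.

So ft(g_γ) = crit^b(a) is decided at the single level q = p^(2N+1): with μ = μ(q), it holds iff
g_γ^μ ∉ b^[q]. Failure means that γ kills the z-polynomials over k which are the coefficients of G^μ
at monomials outside b^[q]; these define V, independently of L. Over an infinite k some γ avoids V,
which gives the maximum in (2); the upper bound there comes from f^j ∈ a^[j] for f ∈ a. -/

namespace FrobeniusThreshold

open MvPolynomial

/-! ### Splitting a polynomial by its exponents modulo `Q`. -/

section Slice

variable {σ R : Type*} [CommRing R]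

/-- The polynomial whose coefficient at `u` is the coefficient of `f` at `Q • u + w`. -/
noncomputable def slice (Q : ℕ) (hQ : 0 < Q) (w : σ →₀ ℕ) (f : MvPolynomial σ R) :
    MvPolynomial σ R :=
  AddMonoidAlgebra.ofCoeff (Finsupp.comapDomain (fun u : σ →₀ ℕ => Q • u + w)
    (AddMonoidAlgebra.coeff f) (by
      intro u _ u' _ h
      have h' : Q • u = Q • u' := add_right_cancel h
      exact nsmul_right_injective hQ.ne' h'))

theorem coeff_slice (Q : ℕ) (hQ : 0 < Q) (w u : σ →₀ ℕ) (f : MvPolynomial σ R) :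
    coeff u (slice Q hQ w f) = coeff (Q • u + w) f := rfl

theorem smul_le_smul_add_iff {Q : ℕ} {u v w : σ →₀ ℕ} (hw : ∀ i, w i < Q) :
    Q • v ≤ Q • u + w ↔ v ≤ u := by
  constructor
  · intro h i
    have h1 : Q * v i ≤ Q * u i + w i := by simpa using h i
    by_contra! h2
    have h3 : Q * (u i + 1) ≤ Q * v i := Nat.mul_le_mul_left _ h2
    have := hw i
    rw [mul_add] at h3
    omega
  · intro h i
    have : Q * v i ≤ Q * u i := Nat.mul_le_mul_left _ (h i)
    simpa using this.trans (Nat.le_add_right _ _)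

/-- The slices f_w are the components in f = Σ x^w f_w(x^Q), with entries of w below Q.
Multiplication by a polynomial in x^Q respects this decomposition. -/
theorem slice_mul_expand {Q : ℕ} (hQ : 0 < Q) {w : σ →₀ ℕ} (hw : ∀ i, w i < Q)
    (f h : MvPolynomial σ R) :
    slice Q hQ w (f * expand Q h) = slice Q hQ w f * h := by
  ext u
  rw [coeff_slice]
  induction h using MvPolynomial.induction_on' generalizing u with
  | add h₁ h₂ ih₁ ih₂ => simp only [map_add, mul_add, coeff_add, ih₁, ih₂]
  | monomial v c =>
    rw [expand_monomial, coeff_mul_monomial', coeff_mul_monomial']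
    simp only [smul_le_smul_add_iff hw]
    split_ifs with hvu
    · rw [coeff_slice]
      congr 2
      ext i
      have : Q * v i ≤ Q * u i := Nat.mul_le_mul_left _ (hvu i)
      simp only [Finsupp.coe_tsub, Finsupp.coe_add, Finsupp.coe_smul, Pi.sub_apply, Pi.add_apply,
        Pi.smul_apply, smul_eq_mul, Nat.mul_sub]
      omega
    · rfl

theorem slice_eq_C {Q : ℕ} (hQ : 0 < Q) {w : σ →₀ ℕ} {f : MvPolynomial σ R}
    (hf : ∀ v ∈ f.support, ∀ i, v i < Q) :
    slice Q hQ w f = C (coeff w f) := by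
  classical
  ext u
  rw [coeff_slice, coeff_C]
  split_ifs with h
  · subst h; simp
  · by_contra h0
    apply h
    have := hf _ (mem_support_iff.mpr h0)
    ext i
    have hi := this i
    simp only [Finsupp.coe_add, Finsupp.coe_smul, Pi.add_apply, Pi.smul_apply, smul_eq_mul] at hi
    by_contra h1
    have : Q * 1 ≤ Q * u i := Nat.mul_le_mul_left _ (Nat.pos_of_ne_zero fun h2 => h1 (by simp [h2]))
    omega

theorem exists_eq_smul_add {Q : ℕ} (hQ : 0 < Q) (v : σ →₀ ℕ) :
    ∃ u w : σ →₀ ℕ, v = Q • u + w ∧ ∀ i, w i < Q := by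
  refine ⟨v.mapRange (· / Q) (by simp), v.mapRange (· % Q) (by simp), ?_, fun i => ?_⟩
  · ext i
    exact (Nat.div_add_mod (v i) Q).symm
  · exact Nat.mod_lt _ hQ

theorem pow_eq_expand (p : ℕ) [ExpChar R p] (c : ℕ) (f : MvPolynomial σ R) :
    f ^ p ^ c = expand (p ^ c) (map (iterateFrobenius R p c) f) := by
  rw [← map_iterateFrobenius_expand, map_expand]

/-- Frobenius is moved onto the coefficients of `h` instead of extracting roots from those of `f`,
so `R` need not be perfect. -/
theorem slice_mul_pow (p : ℕ) [ExpChar R p] (c : ℕ) (hQ : 0 < p ^ c) {w : σ →₀ ℕ}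
    (hw : ∀ i, w i < p ^ c) (f h : MvPolynomial σ R) :
    slice (p ^ c) hQ w (f * h ^ p ^ c) =
      slice (p ^ c) hQ w f * map (iterateFrobenius R p c) h := by
  rw [pow_eq_expand, slice_mul_expand hQ hw]

end Slice

/-! ### Frobenius powers as coefficient ideals. -/

theorem frobPower_zero {R : Type*} [CommRing R] (p : ℕ) (a : Ideal R) : frobPower p a 0 = ⊤ := by
  simp [frobPower]

section BracketPower

variable {R : Type*} [CommRing R] (p : ℕ) [ExpChar R p]

theorem bracketPower_eq_map (I : Ideal R) (e : ℕ) :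
    bracketPower I (p ^ e) = I.map (iterateFrobenius R p e) := by
  unfold bracketPower Ideal.map
  congr 1
  ext y
  simp [iterateFrobenius_def, eq_comm]

theorem bracketPower_span (T : Set R) (e : ℕ) :
    bracketPower (Ideal.span T) (p ^ e) = Ideal.span ((fun x => x ^ p ^ e) '' T) := by
  rw [bracketPower_eq_map, Ideal.map_span]
  rfl

/-- Splitting off the lowest digit gives the recursion behind the later inductions on `k`. -/
theorem frobPower_of_pos (hp : 1 < p) (a : Ideal R) {k : ℕ} (hk : 0 < k) :
    frobPower p a k = a ^ (k % p) * (frobPower p a (k / p)).map (iterateFrobenius R p 1) := by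
  unfold frobPower
  rw [Nat.digits_def' hp hk, List.length_cons, Finset.prod_range_succ', mul_comm]
  congr 1
  · rw [bracketPower_eq_map, iterateFrobenius_zero, Ideal.map_id]
    simp
  · rw [← Ideal.mapHom_apply, map_prod]
    refine Finset.prod_congr rfl fun i _ => ?_
    rw [Ideal.mapHom_apply, bracketPower_eq_map, bracketPower_eq_map, Ideal.map_map]
    congr 1
    ext x
    simp [iterateFrobenius_def, pow_succ, pow_mul, frobenius_def]

end BracketPower

section CoeffIdeal

variable {τ R : Type*} [CommRing R]

/-- The ideal generated by the coefficients of a polynomial. -/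
def coeffIdeal (F : MvPolynomial τ R) : Ideal R := Ideal.span (Set.range fun w => coeff w F)

theorem coeff_mem_coeffIdeal (F : MvPolynomial τ R) (w : τ →₀ ℕ) : coeff w F ∈ coeffIdeal F :=
  Ideal.subset_span ⟨w, rfl⟩

theorem coeffIdeal_le_iff {F : MvPolynomial τ R} {I : Ideal R} :
    coeffIdeal F ≤ I ↔ ∀ w, coeff w F ∈ I := by
  rw [coeffIdeal, Ideal.span_le, Set.range_subset_iff]
  rfl

theorem coeffIdeal_one : coeffIdeal (1 : MvPolynomial τ R) = ⊤ := by
  rw [Ideal.eq_top_iff_one]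
  simpa using coeff_mem_coeffIdeal (1 : MvPolynomial τ R) 0

theorem coeffIdeal_mul_le (F H : MvPolynomial τ R) :
    coeffIdeal (F * H) ≤ coeffIdeal F * coeffIdeal H := by
  classical
  rw [coeffIdeal_le_iff]
  intro w
  rw [coeff_mul]
  exact Ideal.sum_mem _ fun x _ =>
    Ideal.mul_mem_mul (coeff_mem_coeffIdeal F _) (coeff_mem_coeffIdeal H _)

/-- An exponent p•u + w with w below p determines u and w, so terms of F and of H^p never collide:
each product of their coefficients is itself a coefficient. -/
theorem coeffIdeal_mul_pow (p : ℕ) [ExpChar R p] (hp : 0 < p) {F : MvPolynomial τ R}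
    (hF : ∀ v ∈ F.support, ∀ i, v i < p) (H : MvPolynomial τ R) :
    coeffIdeal (F * H ^ p) = coeffIdeal F * (coeffIdeal H).map (iterateFrobenius R p 1) := by
  have key : ∀ u w : τ →₀ ℕ, (∀ i, w i < p) →
      coeff (p • u + w) (F * H ^ p) = coeff w F * iterateFrobenius R p 1 (coeff u H) := by
    intro u w hw
    have h := slice_mul_pow p 1 (by simpa using hp) (w := w) (by simpa using hw) F H
    rw [slice_eq_C (f := F) _ (by simpa only [pow_one] using hF)] at h
    have h2 := congrArg (coeff u) h
    rw [coeff_slice, coeff_C_mul, coeff_map] at h2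
    simpa using h2
  apply le_antisymm
  · rw [coeffIdeal_le_iff]
    intro v
    obtain ⟨u, w, rfl, hw⟩ := exists_eq_smul_add hp v
    rw [key u w hw]
    exact Ideal.mul_mem_mul (coeff_mem_coeffIdeal _ _)
      (Ideal.mem_map_of_mem _ (coeff_mem_coeffIdeal _ _))
  · rw [coeffIdeal, coeffIdeal, Ideal.map_span, Ideal.span_mul_span', Ideal.span_le]
    rintro _ ⟨_, ⟨w, rfl⟩, _, ⟨_, ⟨u, rfl⟩, rfl⟩, rfl⟩
    by_cases hw : ∀ i, w i < p
    · simp only [SetLike.mem_coe]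
      rw [← key u w hw]
      exact coeff_mem_coeffIdeal _ _
    · have : coeff w F = 0 := by
        by_contra h0
        exact hw (hF w (mem_support_iff.mpr h0))
      simp [this]

end CoeffIdeal

section GenericCombination

variable {R : Type*} [CommRing R] {m : ℕ} (g : Fin m → R)

/-- The linear form with coefficients `g₁, …, g_m`. -/
noncomputable def linearForm : MvPolynomial (Fin m) R := ∑ j, C (g j) * X j

theorem pderiv_linearForm (j : Fin m) : pderiv j (linearForm g) = C (g j) := by
  classical
  simp [linearForm, Derivation.leibniz, pderiv_X, Pi.single_apply]

theorem coeffIdeal_linearForm_le : coeffIdeal (linearForm g) ≤ Ideal.span (Set.range g) := by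
  classical
  rw [coeffIdeal_le_iff]
  intro w
  rw [linearForm, coeff_sum]
  refine Ideal.sum_mem _ fun j _ => ?_
  rw [coeff_C_mul]
  exact Ideal.mul_mem_right _ _ (Ideal.subset_span ⟨j, rfl⟩)

theorem support_linearForm_pow_lt {k p : ℕ} (hk : k < p) :
    ∀ v ∈ (linearForm g ^ k).support, ∀ i, v i < p := by
  classical
  intro v hv i
  refine lt_of_le_of_lt ?_ hk
  have h1 : degreeOf i (linearForm g) ≤ 1 := by
    refine (degreeOf_sum_le _ _ _).trans (Finset.sup_le fun j _ => ?_)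
    refine (degreeOf_C_mul_le _ _ _).trans ?_
    have : Nontrivial R := ⟨_, _, mem_support_iff.mp hv⟩
    rw [degreeOf_X]
    split_ifs <;> simp
  calc v i ≤ degreeOf i (linearForm g ^ k) := monomial_le_degreeOf i hv
    _ ≤ k * degreeOf i (linearForm g) := degreeOf_pow_le _ _ _
    _ ≤ k * 1 := Nat.mul_le_mul_left _ h1
    _ = k := mul_one k

/-- For the inclusion ⊇, differentiate: ∂_j(ℓ^(k+1)) = (k+1) g_j ℓ^k has coefficients that are
integer multiples of those of ℓ^(k+1), and k+1 < p is a unit. -/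
theorem coeffIdeal_linearForm_pow {p : ℕ} (hu : ∀ j, 0 < j → j < p → IsUnit (j : R))
    {k : ℕ} (hk : k < p) :
    coeffIdeal (linearForm g ^ k) = Ideal.span (Set.range g) ^ k := by
  induction k with
  | zero => simp [coeffIdeal_one]
  | succ k ih =>
    have ih := ih (by omega)
    apply le_antisymm
    · rw [pow_succ, pow_succ, ← ih]
      exact (coeffIdeal_mul_le _ _).trans (Ideal.mul_mono_right (coeffIdeal_linearForm_le g))
    · rw [pow_succ, ← ih, coeffIdeal, Ideal.span_mul_span', Ideal.span_le]
      rintro _ ⟨_, ⟨w, rfl⟩, _, ⟨j, rfl⟩, rfl⟩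
      have h := congrArg (coeff w) ((pderiv j).leibniz_pow (linearForm g) (k + 1))
      rw [pderiv_linearForm, coeff_pderiv, Nat.add_sub_cancel, smul_eq_mul, nsmul_eq_mul,
        ← map_natCast (C : R →+* MvPolynomial (Fin m) R), coeff_C_mul,
        mul_comm (linearForm g ^ k), coeff_C_mul] at h
      simp only [SetLike.mem_coe]
      rw [← Ideal.unit_mul_mem_iff_mem _ (hu (k + 1) (by omega) hk), mul_comm _ (g j), ← h]
      exact Ideal.mul_mem_right _ _ (coeff_mem_coeffIdeal _ _)

/-- The factorization ℓ^k = ℓ^(k % p) · (ℓ^(k / p))^p matches the digit recursion. -/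
theorem coeffIdeal_linearForm_pow_eq_frobPower (p : ℕ) [ExpChar R p] (hp : 1 < p)
    (hu : ∀ j, 0 < j → j < p → IsUnit (j : R)) (k : ℕ) :
    coeffIdeal (linearForm g ^ k) = frobPower p (Ideal.span (Set.range g)) k := by
  induction k using Nat.strong_induction_on with
  | _ k ih =>
    rcases Nat.eq_zero_or_pos k with rfl | hk
    · rw [pow_zero, coeffIdeal_one, frobPower_zero]
    · have hlt : k % p < p := Nat.mod_lt _ (by omega)
      rw [frobPower_of_pos p hp _ hk, ← ih _ (Nat.div_lt_self hk hp),
        ← coeffIdeal_linearForm_pow g hu hlt,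
        ← coeffIdeal_mul_pow p (by omega) (support_linearForm_pow_lt g hlt),
        ← pow_mul, ← pow_add, mul_comm (k / p) p, Nat.mod_add_div]

theorem pow_mem_frobPower (p : ℕ) [ExpChar R p] (hp : 1 < p) {a : Ideal R} {f : R} (hf : f ∈ a)
    (k : ℕ) : f ^ k ∈ frobPower p a k := by
  induction k using Nat.strong_induction_on with
  | _ k ih =>
    rcases Nat.eq_zero_or_pos k with rfl | hk
    · rw [frobPower_zero]; trivial
    · rw [frobPower_of_pos p hp _ hk]
      have h := Ideal.mul_mem_mul (Ideal.pow_mem_pow hf (k % p))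
        (Ideal.mem_map_of_mem (iterateFrobenius R p 1) (ih _ (Nat.div_lt_self hk hp)))
      rwa [iterateFrobenius_def, pow_one, ← pow_mul, ← pow_add, mul_comm (k / p) p,
        Nat.mod_add_div] at h

end GenericCombination

/-- The ideal of `K[x]` generated by the monomials with exponents in `S`. -/
noncomputable def monIdeal {σ : Type*} (K : Type*) [CommRing K] (S : Set (σ →₀ ℕ)) :
    Ideal (MvPolynomial σ K) :=
  Ideal.span ((fun u => monomial u (1 : K)) '' S)

theorem extendIdeal_monIdeal {σ K : Type*} [CommRing K] (L : Type*) [CommRing L] [Algebra K L]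
    (S : Set (σ →₀ ℕ)) : extendIdeal L (monIdeal K S) = monIdeal L S := by
  rw [extendIdeal, monIdeal, monIdeal, Ideal.map_span, Set.image_image]
  simp

/-! ### Membership in `b^[q]` and the sequence `ν(q)`. -/

section MonomialIdeal

variable {σ F : Type*} [Field F] (p : ℕ) [Fact p.Prime] [CharP F p] {S : Set (σ →₀ ℕ)}

theorem mem_bracketPower_monIdeal {e : ℕ} {f : MvPolynomial σ F} :
    f ∈ bracketPower (monIdeal F S) (p ^ e) ↔
      ∀ u, coeff u f ≠ 0 → ∃ s ∈ S, p ^ e • s ≤ u := by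
  have h : bracketPower (monIdeal F S) (p ^ e) =
      Ideal.span ((fun u => monomial u (1 : F)) '' ((fun s => p ^ e • s) '' S)) := by
    rw [monIdeal, bracketPower_span, Set.image_image, Set.image_image]
    simp [monomial_pow]
  rw [h, mem_ideal_span_monomial_image]
  simp

theorem mem_bracketPower_iff_forall_slice {e c : ℕ} (hQ : 0 < p ^ c) {f : MvPolynomial σ F} :
    f ∈ bracketPower (monIdeal F S) (p ^ (e + c)) ↔
      ∀ w : σ →₀ ℕ, (∀ i, w i < p ^ c) →
        slice (p ^ c) hQ w f ∈ bracketPower (monIdeal F S) (p ^ e) := by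
  simp only [mem_bracketPower_monIdeal, coeff_slice]
  constructor
  · intro h w hw u hu
    obtain ⟨s, hs, hle⟩ := h _ hu
    refine ⟨s, hs, ?_⟩
    rwa [pow_add, mul_comm, mul_smul, smul_le_smul_add_iff hw] at hle
  · intro h v hv
    obtain ⟨u, w, rfl, hw⟩ := exists_eq_smul_add hQ v
    obtain ⟨s, hs, hle⟩ := h w hw u hv
    refine ⟨s, hs, ?_⟩
    rwa [pow_add, mul_comm, mul_smul, smul_le_smul_add_iff hw]

theorem map_mem_bracketPower_iff {L : Type*} [Field L] [CharP L p] (φ : F →+* L) {e : ℕ}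
    {h : MvPolynomial σ F} :
    map φ h ∈ bracketPower (monIdeal L S) (p ^ e) ↔
      h ∈ bracketPower (monIdeal F S) (p ^ e) := by
  simp [mem_bracketPower_monIdeal, coeff_map]

theorem mul_pow_mem_bracketPower_iff {e c : ℕ} (hQ : 0 < p ^ c) {f h : MvPolynomial σ F} :
    f * h ^ p ^ c ∈ bracketPower (monIdeal F S) (p ^ (e + c)) ↔
      ∀ w : σ →₀ ℕ, (∀ i, w i < p ^ c) →
        slice (p ^ c) hQ w f * map (iterateFrobenius F p c) h ∈
          bracketPower (monIdeal F S) (p ^ e) := by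
  rw [mem_bracketPower_iff_forall_slice p hQ]
  refine forall₂_congr fun w hw => ?_
  rw [slice_mul_pow p c hQ hw]

/-- Since all exponents of `f` are below p^c, its slices are constants, and one of them is a unit.
-/
theorem mem_bracketPower_of_mul_pow_mem {e c : ℕ} {f h : MvPolynomial σ F} (hf : f ≠ 0)
    (hd : ∀ v ∈ f.support, ∀ i, v i < p ^ c)
    (hfh : f * h ^ p ^ c ∈ bracketPower (monIdeal F S) (p ^ (e + c))) :
    h ∈ bracketPower (monIdeal F S) (p ^ e) := by
  have hQ : 0 < p ^ c := pow_pos (Nat.Prime.pos Fact.out) c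
  obtain ⟨w, hw⟩ := MvPolynomial.ne_zero_iff.mp hf
  have h1 := (mul_pow_mem_bracketPower_iff p hQ).mp hfh w (hd w (mem_support_iff.mpr hw))
  rw [slice_eq_C hQ hd] at h1
  have h2 := Ideal.mul_mem_left _ (C (coeff w f)⁻¹) h1
  rw [← mul_assoc, ← C_mul, inv_mul_cancel₀ hw, C_1, one_mul] at h2
  exact (map_mem_bracketPower_iff p _).mp h2

theorem pow_mem_bracketPower_iff {e c : ℕ} {h : MvPolynomial σ F} :
    h ^ p ^ c ∈ bracketPower (monIdeal F S) (p ^ (e + c)) ↔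
      h ∈ bracketPower (monIdeal F S) (p ^ e) := by
  have hQ : 0 < p ^ c := pow_pos (Nat.Prime.pos Fact.out) c
  constructor
  · intro hh
    refine mem_bracketPower_of_mul_pow_mem p (f := 1) one_ne_zero ?_ (by rwa [one_mul])
    intro v hv i
    classical
    have : v = 0 := by
      by_contra h0
      exact mem_support_iff.mp hv (by rw [coeff_one, if_neg (Ne.symm h0)])
    simpa [this] using hQ
  · intro hh
    rw [← one_mul (h ^ p ^ c), mul_pow_mem_bracketPower_iff p hQ]
    intro w _
    exact Ideal.mul_mem_left _ _ ((map_mem_bracketPower_iff p _).mpr hh)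

theorem one_notMem_bracketPower (hS : (0 : σ →₀ ℕ) ∉ S) (e : ℕ) :
    (1 : MvPolynomial σ F) ∉ bracketPower (monIdeal F S) (p ^ e) := by
  rw [mem_bracketPower_monIdeal]
  intro h
  obtain ⟨s, hs, hle⟩ := h 0 (by simp)
  have h0 : p ^ e • s = 0 := le_antisymm hle (zero_le)
  rw [smul_eq_zero_iff_right (pow_pos (Nat.Prime.pos Fact.out) e).ne'] at h0
  exact hS (h0 ▸ hs)

theorem span_singleton_pow_le_iff {R : Type*} [CommRing R] {f : R} {k : ℕ} {I : Ideal R} :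
    Ideal.span {f} ^ k ≤ I ↔ f ^ k ∈ I := by
  rw [Ideal.span_singleton_pow, Ideal.span_singleton_le_iff_mem]

/-- Radical membership bounds the set of exponents and properness puts 0 in it, so the `sSup` is a
genuine maximum; the set is also downward closed. -/
theorem pow_mem_bracketPower_iff_fNu_lt (hS : (0 : σ →₀ ℕ) ∉ S) {f : MvPolynomial σ F}
    (hf : f ∈ (monIdeal F S).radical) (e k : ℕ) :
    f ^ k ∈ bracketPower (monIdeal F S) (p ^ e) ↔
      fNu (monIdeal F S) (Ideal.span {f}) (p ^ e) < k := by
  obtain ⟨M, hM⟩ := hf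
  have hb : BddAbove {k : ℕ | ¬ Ideal.span {f} ^ k ≤ bracketPower (monIdeal F S) (p ^ e)} := by
    refine ⟨M * p ^ e, fun j hj => ?_⟩
    by_contra! hlt
    apply hj
    rw [span_singleton_pow_le_iff]
    refine Ideal.mem_of_dvd _ (pow_dvd_pow f hlt.le) ?_
    rw [pow_mul]
    exact Ideal.subset_span ⟨_, hM, rfl⟩
  have hne : {k : ℕ | ¬ Ideal.span {f} ^ k ≤ bracketPower (monIdeal F S) (p ^ e)}.Nonempty :=
    ⟨0, by
      rw [Set.mem_ofPred_eq, span_singleton_pow_le_iff, pow_zero]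
      exact one_notMem_bracketPower p hS e⟩
  constructor
  · intro h
    by_contra! hle
    have hmem := Nat.sSup_mem hne hb
    rw [Set.mem_ofPred_eq, span_singleton_pow_le_iff] at hmem
    exact hmem (Ideal.mem_of_dvd _ (pow_dvd_pow f hle) h)
  · intro h
    by_contra hn
    exact absurd (le_csSup hb (by rwa [Set.mem_ofPred_eq, span_singleton_pow_le_iff])) (not_le.mpr h)

/-- Both sides are compared with ν at the common level e + e'. -/
theorem fNu_mul_pow_lt (hS : (0 : σ →₀ ℕ) ∉ S) {f : MvPolynomial σ F}
    (hf : f ∈ (monIdeal F S).radical) (e e' : ℕ) :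
    fNu (monIdeal F S) (Ideal.span {f}) (p ^ e') * p ^ e <
      (fNu (monIdeal F S) (Ideal.span {f}) (p ^ e) + 1) * p ^ e' := by
  set ν := fun e => fNu (monIdeal F S) (Ideal.span {f}) (p ^ e) with hν
  have key : ∀ e k, f ^ k ∈ bracketPower (monIdeal F S) (p ^ e) ↔ ν e < k :=
    pow_mem_bracketPower_iff_fNu_lt p hS hf
  change ν e' * p ^ e < (ν e + 1) * p ^ e'
  have h1 : ¬ ν (e' + e) < ν e' * p ^ e := by
    rw [← key, pow_mul, pow_mem_bracketPower_iff, key]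
    exact lt_irrefl _
  have h2 : ν (e + e') < (ν e + 1) * p ^ e' := by
    rw [← key, pow_mul, pow_mem_bracketPower_iff, key]
    exact Nat.lt_succ_self _
  rw [add_comm] at h2
  omega

theorem fNu_div_le (hS : (0 : σ →₀ ℕ) ∉ S) {f : MvPolynomial σ F}
    (hf : f ∈ (monIdeal F S).radical) (e e' : ℕ) :
    (fNu (monIdeal F S) (Ideal.span {f}) (p ^ e') : ℝ) / (p : ℝ) ^ e' ≤
      ((fNu (monIdeal F S) (Ideal.span {f}) (p ^ e) : ℝ) + 1) / (p : ℝ) ^ e := by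
  have hp : (0 : ℝ) < p := by exact_mod_cast Nat.Prime.pos Fact.out
  rw [div_le_div_iff₀ (pow_pos hp _) (pow_pos hp _)]
  exact_mod_cast (fNu_mul_pow_lt p hS hf e e').le

theorem fNu_div_le_fThreshold (hS : (0 : σ →₀ ℕ) ∉ S) {f : MvPolynomial σ F}
    (hf : f ∈ (monIdeal F S).radical) (e : ℕ) :
    (fNu (monIdeal F S) (Ideal.span {f}) (p ^ e) : ℝ) / (p : ℝ) ^ e ≤
      fThreshold p (monIdeal F S) (Ideal.span {f}) :=
  le_ciSup (f := fun e : ℕ => (fNu (monIdeal F S) (Ideal.span {f}) (p ^ e) : ℝ) / (p : ℝ) ^ e)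
    ⟨_, by rintro _ ⟨e', rfl⟩; exact fNu_div_le p hS hf 0 e'⟩ e

theorem fThreshold_le (hS : (0 : σ →₀ ℕ) ∉ S) {f : MvPolynomial σ F}
    (hf : f ∈ (monIdeal F S).radical) (e : ℕ) :
    fThreshold p (monIdeal F S) (Ideal.span {f}) ≤
      ((fNu (monIdeal F S) (Ideal.span {f}) (p ^ e) : ℝ) + 1) / (p : ℝ) ^ e :=
  ciSup_le fun e' => fNu_div_le p hS hf e e'

/-- Once p^c exceeds the degree of f, also f · (f^ν)^(p^c) stays outside b^[p^(e+c)], so ν(p^(e+c))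
≥ p^c ν(p^e) + 1. For f = 0 strictness fails. -/
theorem fNu_div_lt_fThreshold (hS : (0 : σ →₀ ℕ) ∉ S) {f : MvPolynomial σ F}
    (hf : f ∈ (monIdeal F S).radical) (hf0 : f ≠ 0) (e : ℕ) :
    (fNu (monIdeal F S) (Ideal.span {f}) (p ^ e) : ℝ) / (p : ℝ) ^ e <
      fThreshold p (monIdeal F S) (Ideal.span {f}) := by
  have hp1 : 1 < p := Nat.Prime.one_lt Fact.out
  have hp : (0 : ℝ) < p := by exact_mod_cast hp1.le
  set k := fNu (monIdeal F S) (Ideal.span {f}) (p ^ e) with hk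
  set c := f.totalDegree
  have hd : ∀ v ∈ f.support, ∀ i, v i < p ^ c := fun v hv i =>
    lt_of_le_of_lt ((monomial_le_degreeOf i hv).trans (degreeOf_le_totalDegree f i))
      (Nat.lt_pow_self hp1)
  have h1 : ¬ fNu (monIdeal F S) (Ideal.span {f}) (p ^ (e + c)) < 1 + k * p ^ c := by
    rw [← pow_mem_bracketPower_iff_fNu_lt p hS hf, pow_add f, pow_one, pow_mul]
    intro h
    have := mem_bracketPower_of_mul_pow_mem p hf0 hd h
    rw [pow_mem_bracketPower_iff_fNu_lt p hS hf] at this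
    exact lt_irrefl _ this
  refine lt_of_lt_of_le ?_ (fNu_div_le_fThreshold p hS hf (e + c))
  rw [div_lt_div_iff₀ (pow_pos hp _) (pow_pos hp _), pow_add, mul_comm ((p : ℝ) ^ e), ← mul_assoc]
  refine mul_lt_mul_of_pos_right ?_ (pow_pos hp _)
  have h2 : k * p ^ c < fNu (monIdeal F S) (Ideal.span {f}) (p ^ (e + c)) := by omega
  exact_mod_cast h2

end MonomialIdeal

/-! ### Rationality of thresholds with bounded denominators. -/

/-- In a nontrivial relation among the `h e`, let `e₀` have the least `s`: all other terms lie in `W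
e₀`, forcing `h e₀` into it. So the `h e` are independent in a space of dimension (D+1)^|σ|. -/
theorem card_le_of_triangular {σ F ι : Type*} [Fintype σ] [Field F] [Fintype ι] (D : ℕ)
    (h : ι → MvPolynomial σ F) (hD : ∀ e u, coeff u (h e) ≠ 0 → ∀ i, u i ≤ D)
    (s : ι → ℝ) (hs : Function.Injective s) (W : ι → Submodule F (MvPolynomial σ F))
    (hW : ∀ e, h e ∉ W e) (hW' : ∀ e e', s e' < s e → h e ∈ W e') :
    Fintype.card ι ≤ (D + 1) ^ Fintype.card σ := by
  classical
  let v : ι → (σ → Fin (D + 1)) → F := fun e r =>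
    coeff (Finsupp.equivFunOnFinite.symm fun i => (r i : ℕ)) (h e)
  have hli : LinearIndependent F v := by
    rw [Fintype.linearIndependent_iff]
    intro c hc
    have hsum : ∑ e, c e • h e = 0 := by
      ext u
      rw [coeff_sum, coeff_zero]
      by_cases hu : ∀ i, u i ≤ D
      · have h1 := congrFun hc fun i => ⟨u i, Nat.lt_succ_of_le (hu i)⟩
        simp only [Finset.sum_apply, Pi.smul_apply, Pi.zero_apply, v] at h1
        have h2 : (Finsupp.equivFunOnFinite.symm fun i => u i) = u := by ext; rfl
        rw [h2] at h1
        simpa [coeff_smul] using h1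
      · refine Finset.sum_eq_zero fun e _ => ?_
        have : coeff u (h e) = 0 := by
          by_contra h0
          exact hu (hD e u h0)
        rw [coeff_smul, this, smul_zero]
    by_contra! hne
    obtain ⟨e₁, he₁⟩ := hne
    obtain ⟨e₀, he₀, hmin⟩ := Finset.exists_min_image (Finset.univ.filter fun e => c e ≠ 0) s
      ⟨e₁, by simpa using he₁⟩
    have hc₀ : c e₀ ≠ 0 := by simpa using he₀
    have hrest : ∑ e ∈ Finset.univ.erase e₀, c e • h e ∈ W e₀ := by
      refine Submodule.sum_mem _ fun e he => ?_
      by_cases hce : c e = 0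
      · simp [hce]
      · refine Submodule.smul_mem _ _ (hW' e e₀ ?_)
        refine lt_of_le_of_ne (hmin e (by simpa using hce)) fun heq => ?_
        exact Finset.ne_of_mem_erase he (hs heq).symm
    rw [← Finset.add_sum_erase _ _ (Finset.mem_univ e₀)] at hsum
    have : c e₀ • h e₀ ∈ W e₀ := by
      rw [eq_neg_of_add_eq_zero_left hsum]
      exact Submodule.neg_mem _ hrest
    exact hW e₀ ((Submodule.smul_mem_iff _ hc₀).mp this)
  simpa using hli.fintype_card_le_finrank

section Rationality

variable {σ F : Type*} [Field F] (p : ℕ) [Fact p.Prime] [CharP F p] {S : Set (σ →₀ ℕ)}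

/-- With t the threshold, ν(q) < q t ≤ ν(q) + 1 says that f^j ∈ b^[q] iff q t ≤ j; here q = p^(e+c)
and j = l + p^c ν(p^e). -/
theorem pow_mul_pow_mem_iff_le (hS : (0 : σ →₀ ℕ) ∉ S) {f : MvPolynomial σ F}
    (hf : f ∈ (monIdeal F S).radical) (hf0 : f ≠ 0) (e c l : ℕ) :
    f ^ l * (f ^ fNu (monIdeal F S) (Ideal.span {f}) (p ^ e)) ^ p ^ c ∈
        bracketPower (monIdeal F S) (p ^ (e + c)) ↔
      (p : ℝ) ^ c * ((p : ℝ) ^ e * fThreshold p (monIdeal F S) (Ideal.span {f}) -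
        fNu (monIdeal F S) (Ideal.span {f}) (p ^ e)) ≤ l := by
  have hp : (0 : ℝ) < p := by exact_mod_cast Nat.Prime.pos Fact.out
  have h1 := fNu_div_lt_fThreshold p hS hf hf0 (e + c)
  have h2 := fThreshold_le p hS hf (e + c)
  rw [div_lt_iff₀ (pow_pos hp _), pow_add (p : ℝ)] at h1
  rw [le_div_iff₀ (pow_pos hp _), pow_add (p : ℝ)] at h2
  rw [← pow_mul, ← pow_add, pow_mem_bracketPower_iff_fNu_lt p hS hf]
  set t := fThreshold p (monIdeal F S) (Ideal.span {f})
  set ν := fNu (monIdeal F S) (Ideal.span {f}) (p ^ e)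
  set ν' := fNu (monIdeal F S) (Ideal.span {f}) (p ^ (e + c))
  constructor
  · intro h
    have h3 : ((ν' : ℝ) + 1) ≤ l + ν * (p : ℝ) ^ c := by exact_mod_cast h
    linarith
  · intro h
    have h3 : (ν' : ℝ) < l + ν * (p : ℝ) ^ c := by linarith
    exact_mod_cast h3

theorem fThreshold_zero (hS : (0 : σ →₀ ℕ) ∉ S) :
    fThreshold p (monIdeal F S) (Ideal.span {(0 : MvPolynomial σ F)}) = 0 := by
  have h : ∀ e, fNu (monIdeal F S) (Ideal.span {(0 : MvPolynomial σ F)}) (p ^ e) = 0 := by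
    intro e
    have := (pow_mem_bracketPower_iff_fNu_lt (F := F) p hS (f := 0) (Ideal.zero_mem _) e 1).mp
      (by simp)
    omega
  simp only [fThreshold, h, Nat.cast_zero, zero_div, ciSup_const]

theorem exists_pow_gap {ι : Type*} [Finite ι] (s : ι → ℝ) {q : ℝ} (hq : 1 < q) :
    ∃ c : ℕ, ∀ e e', s e' < s e → q ^ c * s e' + 1 ≤ q ^ c * s e := by
  have h : ∀ᶠ c : ℕ in Filter.atTop, ∀ e e', s e' < s e → q ^ c * s e' + 1 ≤ q ^ c * s e := by
    rw [Filter.eventually_all]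
    intro e
    rw [Filter.eventually_all]
    intro e'
    by_cases hlt : s e' < s e
    · have ht := (tendsto_pow_atTop_atTop_of_one_lt hq).atTop_mul_const (sub_pos.mpr hlt)
      filter_upwards [ht.eventually_ge_atTop 1] with c hc _
      linarith
    · exact Filter.Eventually.of_forall fun _ h => absurd h hlt
  exact h.exists

/-- A coincidence among the remainders s_e = p^e t - ν(p^e) ∈ (0, 1] gives the integer. If N+1 of
them were distinct, suitable slices of powers of f would be N+1 independent polynomials in a space
of dimension N. -/
theorem exists_pow_sub_pow_mul_fThreshold [Fintype σ] (hS : (0 : σ →₀ ℕ) ∉ S)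
    {f : MvPolynomial σ F} (hf : f ∈ (monIdeal F S).radical) {D : ℕ}
    (hD : ∀ i, degreeOf i f ≤ D) :
    ∃ i j : ℕ, i < j ∧ j ≤ (D + 1) ^ Fintype.card σ ∧ ∃ z : ℤ,
      ((p : ℝ) ^ j - (p : ℝ) ^ i) * fThreshold p (monIdeal F S) (Ideal.span {f}) = z := by
  rcases eq_or_ne f 0 with rfl | hf0
  · exact ⟨0, 1, Nat.zero_lt_one, Nat.one_le_pow _ _ (Nat.succ_pos D), 0, by
      rw [fThreshold_zero p hS, mul_zero, Int.cast_zero]⟩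
  have hp1 : 1 < p := Nat.Prime.one_lt Fact.out
  have hp : (0 : ℝ) < p := by exact_mod_cast hp1.le
  set N := (D + 1) ^ Fintype.card σ with hN
  set t := fThreshold p (monIdeal F S) (Ideal.span {f}) with ht
  set ν : ℕ → ℕ := fun e => fNu (monIdeal F S) (Ideal.span {f}) (p ^ e) with hν
  let s : Fin (N + 1) → ℝ := fun e => (p : ℝ) ^ (e : ℕ) * t - ν e
  have hs_pos : ∀ e, 0 < s e := by
    intro e
    have := fNu_div_lt_fThreshold p hS hf hf0 e
    rw [div_lt_iff₀ (pow_pos hp _)] at this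
    simp only [s, ht, hν]
    linarith
  have hs_le : ∀ e, s e ≤ 1 := by
    intro e
    have := fThreshold_le p hS hf e
    rw [le_div_iff₀ (pow_pos hp _)] at this
    simp only [s, ht, hν]
    linarith
  by_cases hinj : Function.Injective s
  · exfalso
    -- Scaling by p^c makes the gaps at least 1, so the largest integer `l e` below p^c s_e is still
    -- ≥ p^c s_e' whenever s_e' < s_e.
    obtain ⟨c, hc⟩ := exists_pow_gap s (q := p) (by exact_mod_cast hp1)
    have hQ : 0 < p ^ c := pow_pos (by omega) c
    have hQr : (0 : ℝ) < (p : ℝ) ^ c := pow_pos hp c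
    have hl : ∀ e, ∃ l : ℕ, (l : ℝ) < (p : ℝ) ^ c * s e ∧ (p : ℝ) ^ c * s e ≤ l + 1 := by
      intro e
      have h0 : 0 < (p : ℝ) ^ c * s e := mul_pos hQr (hs_pos e)
      have h1 : 0 < ⌈(p : ℝ) ^ c * s e⌉₊ := Nat.ceil_pos.mpr h0
      refine ⟨⌈(p : ℝ) ^ c * s e⌉₊ - 1, ?_, ?_⟩
      · exact Nat.lt_ceil.mp (by omega)
      · refine (Nat.le_ceil _).trans ?_
        exact_mod_cast (by omega : ⌈(p : ℝ) ^ c * s e⌉₊ ≤ ⌈(p : ℝ) ^ c * s e⌉₊ - 1 + 1)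
    choose l hl_lt hl_le using hl
    -- This keeps the degrees of f^(l e) at most p^c D, hence those of its slices at most D,
    -- independently of c.
    have hlQ : ∀ e, l e ≤ p ^ c := by
      intro e
      have h1 : (l e : ℝ) < (p : ℝ) ^ c :=
        (hl_lt e).trans_le (mul_le_of_le_one_right hQr.le (hs_le e))
      exact_mod_cast h1.le
    have hw : ∀ e : Fin (N + 1), ∃ w : σ →₀ ℕ, (∀ i, w i < p ^ c) ∧
        slice (p ^ c) hQ w (f ^ l e) * map (iterateFrobenius F p c) (f ^ ν e) ∉
          bracketPower (monIdeal F S) (p ^ (e : ℕ)) := by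
      intro e
      have h1 := (pow_mul_pow_mem_iff_le p hS hf hf0 e c (l e)).not.mpr (not_le.mpr (hl_lt e))
      rw [mul_pow_mem_bracketPower_iff p hQ] at h1
      simpa only [not_forall, exists_prop] using h1
    choose w hwQ hw using hw
    have hcard := card_le_of_triangular D (fun e => slice (p ^ c) hQ (w e) (f ^ l e)) ?_ s hinj
      (fun e => ((bracketPower (monIdeal F S) (p ^ (e : ℕ))).restrictScalars F).comap
        (LinearMap.mulRight F (map (iterateFrobenius F p c) (f ^ ν e)))) ?_ ?_
    · rw [Fintype.card_fin] at hcard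
      omega
    · intro e u hu i
      rw [coeff_slice] at hu
      have h1 := monomial_le_degreeOf i (mem_support_iff.mpr hu)
      have h2 : degreeOf i (f ^ l e) ≤ p ^ c * D :=
        (degreeOf_pow_le _ _ _).trans (Nat.mul_le_mul (hlQ e) (hD i))
      have h3 : p ^ c * u i ≤ p ^ c * D := by
        refine le_trans ?_ (h1.trans h2)
        simp
      exact Nat.le_of_mul_le_mul_left h3 hQ
    · intro e he
      exact hw e he
    · intro e e' hlt
      have h1 := (pow_mul_pow_mem_iff_le p hS hf hf0 e' c (l e)).mpr (by
        have := hc e e' hlt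
        have := hl_le e
        change (p : ℝ) ^ c * s e' ≤ l e
        linarith)
      exact (mul_pow_mem_bracketPower_iff p hQ).mp h1 (w e) (hwQ e)
  · have hex : ∃ i j : Fin (N + 1), i < j ∧ s i = s j := by
      simp only [Function.Injective, not_forall] at hinj
      obtain ⟨i, j, hij, hne⟩ := hinj
      rcases lt_or_gt_of_ne hne with h | h
      · exact ⟨i, j, h, hij⟩
      · exact ⟨j, i, h, hij.symm⟩
    obtain ⟨i, j, hlt, hij⟩ := hex
    refine ⟨i, j, hlt, Nat.lt_succ_iff.mp j.2, (ν j : ℤ) - ν i, ?_⟩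
    simp only [s] at hij
    push_cast
    linarith

end Rationality

/-! ### The generic combination and its specializations. -/

section CoeffPoly

variable {σ τ K : Type*} [Field K]

/-- For a polynomial `F` in the variables `τ` with coefficients in `K[x]`, the polynomial over `K`
obtained by taking the coefficient at `u` of each coefficient of `F`. -/
noncomputable def coeffPoly (F : MvPolynomial τ (MvPolynomial σ K)) (u : σ →₀ ℕ) :
    MvPolynomial τ K :=
  ∑ w ∈ F.support, monomial w (coeff u (coeff w F))

theorem coeff_coeffPoly (F : MvPolynomial τ (MvPolynomial σ K)) (u : σ →₀ ℕ) (w : τ →₀ ℕ) :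
    coeff w (coeffPoly F u) = coeff u (coeff w F) := by
  classical
  simp only [coeffPoly, coeff_sum, coeff_monomial, Finset.sum_ite_eq', mem_support_iff, ne_eq,
    ite_not]
  split_ifs with h
  · rw [h, coeff_zero]
  · rfl

theorem coeff_eval₂Hom [Fintype τ] {L : Type*} [Field L] [Algebra K L]
    (F : MvPolynomial τ (MvPolynomial σ K)) (γ : τ → L) (u : σ →₀ ℕ) :
    coeff u (eval₂Hom (map (algebraMap K L)) (fun i => C (γ i)) F : MvPolynomial σ L) =
      aeval γ (coeffPoly F u) := by
  rw [coe_eval₂Hom, eval₂_eq', coeff_sum, coeffPoly, map_sum]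
  refine Finset.sum_congr rfl fun w _ => ?_
  rw [aeval_monomial, mul_comm]
  simp only [← C_pow, ← map_prod]
  rw [coeff_C_mul, coeff_map, mul_comm, Finsupp.prod_fintype _ _ fun i => pow_zero _]

end CoeffPoly

section LinComb

variable {n m : ℕ} {K : Type*} [Field K] (g : Fin m → MvPolynomial (Fin n) K)
  {L : Type*} [Field L] [Algebra K L]

theorem eval₂Hom_linearForm (γ : Fin m → L) :
    eval₂Hom (map (algebraMap K L)) (fun i => C (γ i)) (linearForm g) = linComb g γ := by
  simp [linearForm, linComb, mul_comm]

theorem coeff_linComb_pow (γ : Fin m → L) (j : ℕ) (u : Fin n →₀ ℕ) :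
    coeff u (linComb g γ ^ j) = aeval γ (coeffPoly (linearForm g ^ j) u) := by
  rw [← coeff_eval₂Hom, map_pow, eval₂Hom_linearForm]

theorem degreeOf_linComb_le {D : ℕ} (hD : ∀ j, (g j).totalDegree ≤ D) (γ : Fin m → L)
    (i : Fin n) : degreeOf i (linComb g γ) ≤ D := by
  refine (degreeOf_sum_le _ _ _).trans (Finset.sup_le fun j _ => ?_)
  refine (degreeOf_C_mul_le _ _ _).trans ?_
  rw [degreeOf_le_iff]
  intro u hu
  exact (monomial_le_degreeOf i (support_map_subset _ _ hu)).trans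
    ((degreeOf_le_totalDegree _ _).trans (hD j))

theorem linComb_mem_radical {S : Set (Fin n →₀ ℕ)} (hg : ∀ j, g j ∈ (monIdeal K S).radical)
    (γ : Fin m → L) : linComb g γ ∈ (monIdeal L S).radical := by
  refine Ideal.sum_mem _ fun j _ => Ideal.mul_mem_left _ _ ?_
  obtain ⟨M, hM⟩ := hg j
  refine ⟨M, ?_⟩
  rw [← map_pow, ← extendIdeal_monIdeal (K := K) L S]
  exact Ideal.mem_map_of_mem _ hM

theorem linComb_pow_mem_iff (p : ℕ) [Fact p.Prime] [CharP L p] (S : Set (Fin n →₀ ℕ))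
    (γ : Fin m → L) (j e : ℕ) :
    linComb g γ ^ j ∈ bracketPower (monIdeal L S) (p ^ e) ↔
      ∀ u, (¬ ∃ s ∈ S, p ^ e • s ≤ u) → aeval γ (coeffPoly (linearForm g ^ j) u) = 0 := by
  rw [mem_bracketPower_monIdeal]
  refine forall_congr' fun u => ?_
  rw [coeff_linComb_pow, not_imp_comm]

theorem isUnit_natCast_of_lt (p : ℕ) [CharP K p] (j : ℕ) (hj : 0 < j) (hjp : j < p) :
    IsUnit (j : MvPolynomial (Fin n) K) := by
  rw [← map_natCast (C : K →+* MvPolynomial (Fin n) K)]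
  refine IsUnit.map _ (isUnit_iff_ne_zero.mpr ?_)
  rw [Ne, CharP.cast_eq_zero_iff K p]
  exact Nat.not_dvd_of_pos_of_lt hj hjp

variable (p : ℕ) [Fact p.Prime] [CharP K p] (S : Set (Fin n →₀ ℕ))

/-- The polynomials whose values at γ govern g_γ^j in `linComb_pow_mem_iff` reappear here, now
required to vanish identically. -/
theorem frobPower_le_iff (j e : ℕ) :
    frobPower p (Ideal.span (Set.range g)) j ≤ bracketPower (monIdeal K S) (p ^ e) ↔
      ∀ u, (¬ ∃ s ∈ S, p ^ e • s ≤ u) → coeffPoly (linearForm g ^ j) u = 0 := by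
  rw [← coeffIdeal_linearForm_pow_eq_frobPower g p (Nat.Prime.one_lt Fact.out)
    (isUnit_natCast_of_lt p), coeffIdeal_le_iff]
  simp only [mem_bracketPower_monIdeal, MvPolynomial.ext_iff, coeff_coeffPoly, coeff_zero]
  constructor
  · intro h u hu w
    by_contra h0
    exact hu (h w u h0)
  · intro h w u h0
    by_contra hu
    exact h0 (h u hu w)

/-- The linear combination of the `gᵢ` whose coefficients are independent transcendentals. -/
noncomputable def genericComb :
    MvPolynomial (Fin n) (FractionRing (MvPolynomial (Fin m) K)) :=
  linComb g fun i => algebraMap (MvPolynomial (Fin m) K) _ (X i)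

variable {S} in
theorem genericComb_mem_radical (hg : ∀ j, g j ∈ (monIdeal K S).radical) :
    genericComb g ∈ (monIdeal (FractionRing (MvPolynomial (Fin m) K)) S).radical :=
  linComb_mem_radical g hg _

theorem aeval_generic (P : MvPolynomial (Fin m) K) :
    aeval (fun i => algebraMap (MvPolynomial (Fin m) K)
      (FractionRing (MvPolynomial (Fin m) K)) (X i)) P = algebraMap _ _ P := by
  rw [show (fun i => algebraMap (MvPolynomial (Fin m) K)
    (FractionRing (MvPolynomial (Fin m) K)) (X i)) = algebraMap _ _ ∘ X from rfl,
    aeval_algebraMap_apply, aeval_X_left_apply]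

/-- A polynomial vanishes at the generic point only if it is zero. -/
theorem genericComb_pow_mem_iff (j e : ℕ) :
    genericComb g ^ j ∈ bracketPower (monIdeal (FractionRing (MvPolynomial (Fin m) K)) S) (p ^ e) ↔
      frobPower p (Ideal.span (Set.range g)) j ≤ bracketPower (monIdeal K S) (p ^ e) := by
  rw [genericComb, linComb_pow_mem_iff, frobPower_le_iff]
  simp only [aeval_generic]
  refine forall₂_congr fun u _ => ?_
  exact map_eq_zero_iff _ (IsFractionRing.injective _ _)

theorem critMu_eq_fNu_genericComb (e : ℕ) :
    critMu p (monIdeal K S) (Ideal.span (Set.range g)) (p ^ e) =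
      fNu (monIdeal (FractionRing (MvPolynomial (Fin m) K)) S)
        (Ideal.span {genericComb g}) (p ^ e) := by
  simp only [critMu, fNu, span_singleton_pow_le_iff, genericComb_pow_mem_iff]

theorem critExponent_eq_fThreshold_genericComb :
    critExponent p (monIdeal K S) (Ideal.span (Set.range g)) =
      fThreshold p (monIdeal (FractionRing (MvPolynomial (Fin m) K)) S)
        (Ideal.span {genericComb g}) := by
  simp only [critExponent, fThreshold, critMu_eq_fNu_genericComb]

theorem genericComb_ne_zero {γ : Fin m → L} (h : linComb g γ ≠ 0) : genericComb g ≠ 0 := by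
  obtain ⟨u, hu⟩ := MvPolynomial.ne_zero_iff.mp h
  rw [← pow_one (linComb g γ), coeff_linComb_pow] at hu
  refine MvPolynomial.ne_zero_iff.mpr ⟨u, ?_⟩
  rw [← pow_one (genericComb g), genericComb, coeff_linComb_pow, aeval_generic]
  intro h0
  rw [map_eq_zero_iff _ (IsFractionRing.injective _ _)] at h0
  rw [h0, map_zero] at hu
  exact hu rfl

end LinComb

/-! ### Deciding equality of thresholds at one level. -/

theorem eq_of_pow_sub_pow_mul_eq_int {p : ℕ} (hp : 1 < p) {N i j i' j' : ℕ} (hij : i < j)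
    (hj : j ≤ N) (hij' : i' < j') (hj' : j' ≤ N) {x y : ℝ} {z z' : ℤ}
    (hx : ((p : ℝ) ^ j - (p : ℝ) ^ i) * x = z) (hy : ((p : ℝ) ^ j' - (p : ℝ) ^ i') * y = z')
    (hxy : |x - y| ≤ 1 / (p : ℝ) ^ (2 * N + 1)) : x = y := by
  have hp' : (1 : ℝ) < p := by exact_mod_cast hp
  have hp0 : (0 : ℝ) < p := zero_lt_one.trans hp'
  have bound : ∀ {i j : ℕ}, i < j → j ≤ N →
      0 < (p : ℝ) ^ j - (p : ℝ) ^ i ∧ (p : ℝ) ^ j - (p : ℝ) ^ i ≤ (p : ℝ) ^ N := by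
    intro i j hij hj
    have h1 := pow_lt_pow_right₀ hp' hij
    have h2 := pow_le_pow_right₀ hp'.le hj
    have h3 := pow_pos hp0 i
    constructor <;> linarith
  obtain ⟨hA0, hA⟩ := bound hij hj
  obtain ⟨hB0, hB⟩ := bound hij' hj'
  set A := (p : ℝ) ^ j - (p : ℝ) ^ i with hAdef
  set B := (p : ℝ) ^ j' - (p : ℝ) ^ i' with hBdef
  -- This integer is A B (x - y), and A B ≤ p^(2N) makes its absolute value at most 1/p.
  let w : ℤ := ((p : ℤ) ^ j' - (p : ℤ) ^ i') * z - ((p : ℤ) ^ j - (p : ℤ) ^ i) * z'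
  have hw : (w : ℝ) = A * B * (x - y) := by
    simp only [w]
    push_cast
    rw [← hx, ← hy, ← hAdef, ← hBdef]
    ring
  have hlt : |(w : ℝ)| < 1 := by
    rw [hw, abs_mul, abs_of_pos (mul_pos hA0 hB0)]
    calc A * B * |x - y| ≤ ((p : ℝ) ^ N * (p : ℝ) ^ N) * (1 / (p : ℝ) ^ (2 * N + 1)) := by
          gcongr
      _ = 1 / p := by
          rw [pow_succ, two_mul, pow_add]
          field_simp
      _ < 1 := by
          rw [div_lt_one hp0]
          exact hp'
  have hw0 : w = 0 := by
    rw [← Int.cast_abs] at hlt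
    exact Int.abs_lt_one_iff.mp (by exact_mod_cast hlt)
  rw [hw0, Int.cast_zero] at hw
  rcases mul_eq_zero.mp hw.symm with h | h
  · exact absurd h (mul_pos hA0 hB0).ne'
  · linarith

section Comparison

variable {n m : ℕ} {K : Type*} [Field K] (g : Fin m → MvPolynomial (Fin n) K)
  {L : Type*} [Field L] [Algebra K L] (p : ℕ) [Fact p.Prime] [CharP K p] [CharP L p]
  {S : Set (Fin n →₀ ℕ)}

theorem linComb_pow_mem_of_critMu_lt (hS : (0 : Fin n →₀ ℕ) ∉ S)
    (hg : ∀ j, g j ∈ (monIdeal K S).radical) (γ : Fin m → L) {j e : ℕ}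
    (h : critMu p (monIdeal K S) (Ideal.span (Set.range g)) (p ^ e) < j) :
    linComb g γ ^ j ∈ bracketPower (monIdeal L S) (p ^ e) := by
  rw [critMu_eq_fNu_genericComb, ← pow_mem_bracketPower_iff_fNu_lt p hS (genericComb_mem_radical g hg),
    genericComb_pow_mem_iff, frobPower_le_iff] at h
  rw [linComb_pow_mem_iff]
  intro u hu
  rw [h u hu, map_zero]

theorem fNu_le_critMu (hS : (0 : Fin n →₀ ℕ) ∉ S) (hg : ∀ j, g j ∈ (monIdeal K S).radical)
    {f : MvPolynomial (Fin n) K} (hf : f ∈ Ideal.span (Set.range g)) (e : ℕ) :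
    fNu (monIdeal K S) (Ideal.span {f}) (p ^ e) ≤
      critMu p (monIdeal K S) (Ideal.span (Set.range g)) (p ^ e) := by
  have hrad : f ∈ (monIdeal K S).radical :=
    Ideal.span_le.mpr (Set.range_subset_iff.mpr hg) hf
  rw [← Nat.lt_succ_iff, ← pow_mem_bracketPower_iff_fNu_lt p hS hrad]
  refine ((genericComb_pow_mem_iff g p S _ e).mp ?_)
    (pow_mem_frobPower p (Nat.Prime.one_lt Fact.out) hf _)
  rw [pow_mem_bracketPower_iff_fNu_lt p hS (genericComb_mem_radical g hg), critMu_eq_fNu_genericComb]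
  exact Nat.lt_succ_self _

theorem fThreshold_le_critExponent (hS : (0 : Fin n →₀ ℕ) ∉ S)
    (hg : ∀ j, g j ∈ (monIdeal K S).radical)
    {f : MvPolynomial (Fin n) K} (hf : f ∈ Ideal.span (Set.range g)) :
    fThreshold p (monIdeal K S) (Ideal.span {f}) ≤
      critExponent p (monIdeal K S) (Ideal.span (Set.range g)) := by
  refine ciSup_le fun e => ?_
  refine le_trans ?_ (critExponent_eq_fThreshold_genericComb g p S ▸
    fNu_div_le_fThreshold p hS (genericComb_mem_radical g hg) e)
  have := fNu_le_critMu g p hS hg hf e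
  rw [critMu_eq_fNu_genericComb] at this
  gcongr

/-- Both thresholds lie in [μ/q, (μ+1)/q], of length p^(-(2N+1)), which is below the gap between
distinct admissible values. -/
theorem fThreshold_eq_critExponent_of_notMem (hS : (0 : Fin n →₀ ℕ) ∉ S)
    (hg : ∀ j, g j ∈ (monIdeal K S).radical) {D : ℕ} (hD : ∀ j, (g j).totalDegree ≤ D)
    (γ : Fin m → L)
    (h : linComb g γ ^ critMu p (monIdeal K S) (Ideal.span (Set.range g))
        (p ^ (2 * (D + 1) ^ n + 1)) ∉
      bracketPower (monIdeal L S) (p ^ (2 * (D + 1) ^ n + 1))) :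
    fThreshold p (monIdeal L S) (Ideal.span {linComb g γ}) =
      critExponent p (monIdeal K S) (Ideal.span (Set.range g)) := by
  have hp0 : (0 : ℝ) < p := by exact_mod_cast Nat.Prime.pos Fact.out
  have hγ := linComb_mem_radical (L := L) g hg γ
  have hG := genericComb_mem_radical g hg
  obtain ⟨i, j, hij, hj, z, hz⟩ := exists_pow_sub_pow_mul_fThreshold p hS hγ
    (degreeOf_linComb_le g hD γ)
  obtain ⟨i', j', hij', hj', z', hz'⟩ := exists_pow_sub_pow_mul_fThreshold p hS hG
    (degreeOf_linComb_le g hD _)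
  rw [Fintype.card_fin] at hj hj'
  set e := 2 * (D + 1) ^ n + 1 with he
  have hν : fNu (monIdeal L S) (Ideal.span {linComb g γ}) (p ^ e) =
      critMu p (monIdeal K S) (Ideal.span (Set.range g)) (p ^ e) := by
    apply le_antisymm
    · rw [← Nat.lt_succ_iff, ← pow_mem_bracketPower_iff_fNu_lt p hS hγ]
      exact linComb_pow_mem_of_critMu_lt g p hS hg γ (Nat.lt_succ_self _)
    · rwa [pow_mem_bracketPower_iff_fNu_lt p hS hγ, not_lt] at h
  have h1 := fNu_div_le_fThreshold p hS hγ e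
  have h2 := fThreshold_le p hS hγ e
  have h3 := fNu_div_le_fThreshold p hS hG e
  have h4 := fThreshold_le p hS hG e
  rw [hν, critMu_eq_fNu_genericComb] at h1 h2
  rw [critExponent_eq_fThreshold_genericComb]
  refine eq_of_pow_sub_pow_mul_eq_int (Nat.Prime.one_lt Fact.out) hij hj hij' hj' hz hz' ?_
  rw [add_div] at h2 h4
  rw [abs_le]
  constructor <;> linarith

/-- The chain μ/q < crit = ft(g_γ) ≤ (ν+1)/q forces μ ≤ ν. Its strict first step needs G ≠ 0, which
follows from g_γ ≠ 0. -/
theorem notMem_of_fThreshold_eq_critExponent (hS : (0 : Fin n →₀ ℕ) ∉ S)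
    (hg : ∀ j, g j ∈ (monIdeal K S).radical) {γ : Fin m → L} (hγ0 : linComb g γ ≠ 0)
    (h : fThreshold p (monIdeal L S) (Ideal.span {linComb g γ}) =
      critExponent p (monIdeal K S) (Ideal.span (Set.range g))) (e : ℕ) :
    linComb g γ ^ critMu p (monIdeal K S) (Ideal.span (Set.range g)) (p ^ e) ∉
      bracketPower (monIdeal L S) (p ^ e) := by
  have hp0 : (0 : ℝ) < p := by exact_mod_cast Nat.Prime.pos Fact.out
  have hγ := linComb_mem_radical (L := L) g hg γ
  have hG := genericComb_mem_radical g hg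
  rw [pow_mem_bracketPower_iff_fNu_lt p hS hγ, critMu_eq_fNu_genericComb]
  intro hlt
  have h1 := fNu_div_lt_fThreshold p hS hG (genericComb_ne_zero g hγ0) e
  rw [← critExponent_eq_fThreshold_genericComb, ← h] at h1
  have h2 := h1.trans_le (fThreshold_le p hS hγ e)
  rw [div_lt_div_iff_of_pos_right (pow_pos hp0 _)] at h2
  have h3 : fNu (monIdeal _ S) (Ideal.span {genericComb g}) (p ^ e) <
    fNu (monIdeal L S) (Ideal.span {linComb g γ}) (p ^ e) + 1 := by exact_mod_cast h2
  omega

theorem linComb_mem_span (γ : Fin m → K) : linComb g γ ∈ Ideal.span (Set.range g) := by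
  refine Ideal.sum_mem _ fun j _ => Ideal.mul_mem_left _ _ ?_
  rw [Algebra.algebraMap_self, map_id]
  exact Ideal.subset_span ⟨j, rfl⟩

/-- Otherwise the defining polynomials vanish at every point of an infinite field, hence
identically, and a^[μ] ⊆ b^[q] contradicts the choice of μ. -/
theorem exists_linComb_pow_notMem [Infinite K] (hS : (0 : Fin n →₀ ℕ) ∉ S)
    (hg : ∀ j, g j ∈ (monIdeal K S).radical) (e : ℕ) :
    ∃ γ : Fin m → K,
      linComb g γ ^ critMu p (monIdeal K S) (Ideal.span (Set.range g)) (p ^ e) ∉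
        bracketPower (monIdeal K S) (p ^ e) := by
  by_contra! hall
  have hG := genericComb_mem_radical g hg
  have hlt : critMu p (monIdeal K S) (Ideal.span (Set.range g)) (p ^ e) <
      critMu p (monIdeal K S) (Ideal.span (Set.range g)) (p ^ e) := by
    conv_lhs => rw [critMu_eq_fNu_genericComb]
    rw [← pow_mem_bracketPower_iff_fNu_lt p hS hG, genericComb_pow_mem_iff, frobPower_le_iff]
    intro u hu
    refine MvPolynomial.funext fun γ => ?_
    rw [map_zero, ← aeval_eq_eval]
    exact (linComb_pow_mem_iff g p S γ _ e).mp (hall γ) u hu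
  exact lt_irrefl _ hlt

end Comparison

end FrobeniusThreshold

/-- The closed set `V` of affine `m`-space over `k` is given by the ideal `I` of `k[z₁, …, z_m]`
of its equations, and `V_L` is the set of common zeros of these same equations in `L ^ m`. -/
theorem mainTheorem3 (p : ℕ) [Fact p.Prime] (k : Type u) [Field k] [CharP k p]
    (hk : IsFFinite p k) (n m : ℕ) (g : Fin m → MvPolynomial (Fin n) k) (hg : ∀ i, g i ≠ 0)
    (a : Ideal (MvPolynomial (Fin n) k)) (ha : a = Ideal.span (Set.range g))
    (b : Ideal (MvPolynomial (Fin n) k)) (hb : IsMonomialIdeal b) (hb_proper : b ≠ ⊤)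
    (hab : a ≤ b.radical) :
    (∃ I : Ideal (MvPolynomial (Fin m) k),
      ∀ (L : Type v) [Field L] [Algebra k L] [CharP L p], IsFFinite p L →
        ∀ γ : Fin m → L, linComb g γ ≠ 0 →
          (fThreshold p (extendIdeal L b) (Ideal.span {linComb g γ}) = critExponent p b a ↔
            γ ∉ MvPolynomial.zeroLocus L I)) ∧
    (Infinite k →
      IsGreatest {t : ℝ | ∃ f ∈ a, t = fThreshold p b (Ideal.span {f})}
        (critExponent p b a)) := by
  obtain ⟨S, hbS⟩ := hb
  change b = FrobeniusThreshold.monIdeal k S at hbS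
  subst hbS ha
  have hS : (0 : Fin n →₀ ℕ) ∉ S := fun h0 => hb_proper
    ((Ideal.eq_top_iff_one _).mpr (Ideal.subset_span ⟨0, h0, rfl⟩))
  have hrad : ∀ j, g j ∈ (FrobeniusThreshold.monIdeal k S).radical := fun j =>
    hab (Ideal.subset_span ⟨j, rfl⟩)
  set D := Finset.univ.sup fun j => (g j).totalDegree
  have hD : ∀ j, (g j).totalDegree ≤ D := fun j =>
    Finset.le_sup (f := fun j => (g j).totalDegree) (Finset.mem_univ j)
  set e := 2 * (D + 1) ^ n + 1 with he
  set μ := critMu p (FrobeniusThreshold.monIdeal k S) (Ideal.span (Set.range g)) (p ^ e) with hμ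
  -- The equations of V are the coefficients of G^μ at the monomials outside b^[p^e].
  refine ⟨⟨Ideal.span {P | ∃ u, (¬ ∃ s ∈ S, p ^ e • s ≤ u) ∧
    P = FrobeniusThreshold.coeffPoly (FrobeniusThreshold.linearForm g ^ μ) u}, ?_⟩, ?_⟩
  · intro L _ _ _ _ γ hγ
    have hmem : γ ∈ MvPolynomial.zeroLocus L (Ideal.span {P | ∃ u, (¬ ∃ s ∈ S, p ^ e • s ≤ u) ∧
        P = FrobeniusThreshold.coeffPoly (FrobeniusThreshold.linearForm g ^ μ) u}) ↔
        linComb g γ ^ μ ∈ bracketPower (FrobeniusThreshold.monIdeal L S) (p ^ e) := by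
      rw [FrobeniusThreshold.linComb_pow_mem_iff, MvPolynomial.mem_zeroLocus_iff]
      constructor
      · intro h u hu
        exact h _ (Ideal.subset_span ⟨u, hu, rfl⟩)
      · intro h
        change _ ≤ RingHom.ker (MvPolynomial.aeval γ : MvPolynomial (Fin m) k →ₐ[k] L)
        rw [Ideal.span_le]
        rintro _ ⟨u, hu, rfl⟩
        exact h u hu
    rw [hmem, FrobeniusThreshold.extendIdeal_monIdeal]
    exact ⟨fun h => FrobeniusThreshold.notMem_of_fThreshold_eq_critExponent g p hS hrad hγ h e,
      FrobeniusThreshold.fThreshold_eq_critExponent_of_notMem g p hS hrad hD γ⟩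
  · intro _
    constructor
    · obtain ⟨γ, hγ⟩ := FrobeniusThreshold.exists_linComb_pow_notMem g p hS hrad e
      exact ⟨linComb g γ, FrobeniusThreshold.linComb_mem_span g γ,
        (FrobeniusThreshold.fThreshold_eq_critExponent_of_notMem g p hS hrad hD γ hγ).symm⟩
    · rintro _ ⟨f, hf, rfl⟩
      exact FrobeniusThreshold.fThreshold_le_critExponent g p hS hrad hf
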